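/- Let $(X,\mathcal B)$ be a standard Borel space with a probability measure $\mu$, and let $L_p=L_p(X,\mu)$ be the complex $L_p$-spaces. Let $U=(U_t)_{t\in\mathbb R}$ be a $C_0$-group (strongly continuous one-parameter group of bounded operators, $U_0=I$) on $L_2$ such that $U_t(L_\infty)\subseteq L_\infty$ for all $t\in\mathbb R$. Call $U$ *weighted non-singular* if for every $t\in\mathbb R$ there are a map $T_t\colon X\to X$ and a function $\psi_t\colon X\to\mathbb C$ such that $U_tf=\psi_t\cdot(f\circ T_t)$ a.e. for all $f\in L_2$ (whichever representative of $f$ is chosen). Then the following are equivalent. (i) $U$ is weighted non-singular. (ii) For all $t\in\mathbb R$ one has $U_t\mathbf 1\neq 0$ a.e. and $\frac1{U_t\mathbf 1}\in L_\infty$; moreover $V=(V_t)_{t\in\mathbb R}$, where $$V_tf=\frac{1}{U_t\mathbf 1}\,U_tf\qquad(t\in\mathbb R,\ f\in L_2),$$ is a $C_0$-group on $L_2$; and, if $B$ denotes the generator of $V$ with domain $D(B)$, then $D(B)\cap L_\infty$ is an algebra (closed under pointwise multiplication) and $B$ is a derivation on it, that is, $B(fg)=(Bf)\,g+f\,(Bg)$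 for all $f,g\in D(B)\cap L_\infty$. -/

import Mathlib

open MeasureTheory Filter Topology
open scoped ENNReal

noncomputable section

namespace WeightedKoopman

section Group

variable {E : Type*} [NormedAddCommGroup E] [NormedSpace ℂ E]

/-- `U` is a strongly continuous one-parameter group (a `C_0`-group) of bounded operators. -/
structure IsC0Group (U : ℝ → E →L[ℂ] E) : Prop where
  map_zero : U 0 = ContinuousLinearMap.id ℂ E
  map_add : ∀ s t : ℝ, U (s + t) = (U s).comp (U t)
  continuous_orbit : ∀ f : E, Continuous fun t : ℝ => U t f

/-- `g` is the derivative at `0` of the orbit `t ↦ U t f`, that is,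
`g = lim_{t → 0} (1 / t) (U t f - f)`. -/
def HasOrbitDeriv (U : ℝ → E →L[ℂ] E) (f g : E) : Prop :=
  Tendsto (fun t : ℝ => ((t : ℂ)⁻¹) • (U t f - f)) (𝓝[≠] (0 : ℝ)) (𝓝 g)

theorem HasOrbitDeriv.unique {U : ℝ → E →L[ℂ] E} {f g g' : E}
    (h : HasOrbitDeriv U f g) (h' : HasOrbitDeriv U f g') : g = g' :=
  tendsto_nhds_unique h h'

theorem HasOrbitDeriv.add {U : ℝ → E →L[ℂ] E} {f₁ f₂ g₁ g₂ : E}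
    (h₁ : HasOrbitDeriv U f₁ g₁) (h₂ : HasOrbitDeriv U f₂ g₂) :
    HasOrbitDeriv U (f₁ + f₂) (g₁ + g₂) := by
  refine (Tendsto.add h₁ h₂).congr fun t => ?_
  rw [← smul_add, map_add]
  congr 1
  abel

theorem HasOrbitDeriv.smul {U : ℝ → E →L[ℂ] E} {f g : E} (c : ℂ)
    (h : HasOrbitDeriv U f g) : HasOrbitDeriv U (c • f) (c • g) := by
  refine (Tendsto.const_smul h c).congr fun t => ?_
  rw [smul_comm, map_smul, smul_sub]

theorem HasOrbitDeriv.zero (U : ℝ → E →L[ℂ] E) : HasOrbitDeriv U 0 0 := by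
  simp [HasOrbitDeriv, tendsto_const_nhds]

/-- The domain of the generator: all `f` for which `lim_{t → 0} (1 / t) (U t f - f)` exists. -/
def generatorDomain (U : ℝ → E →L[ℂ] E) : Submodule ℂ E where
  carrier := {f | ∃ g, HasOrbitDeriv U f g}
  add_mem' := fun ⟨g₁, h₁⟩ ⟨g₂, h₂⟩ => ⟨g₁ + g₂, h₁.add h₂⟩
  zero_mem' := ⟨0, HasOrbitDeriv.zero U⟩
  smul_mem' := fun c _ ⟨g, h⟩ => ⟨c • g, h.smul c⟩

/-- The generator of a one-parameter group, as an (in general unbounded) operator. -/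
def generator (U : ℝ → E →L[ℂ] E) : E →ₗ.[ℂ] E where
  domain := generatorDomain U
  toFun :=
    { toFun := fun f => Classical.choose f.2
      map_add' := fun f₁ f₂ =>
        (Classical.choose_spec (f₁ + f₂).2).unique
          ((Classical.choose_spec f₁.2).add (Classical.choose_spec f₂.2))
      map_smul' := fun c f =>
        (Classical.choose_spec (c • f).2).unique ((Classical.choose_spec f.2).smul c) }

theorem generator_spec (U : ℝ → E →L[ℂ] E) (f : (generator U).domain) :
    HasOrbitDeriv U (f : E) (generator U f) :=
  Classical.choose_spec f.2

end Group

section L2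

variable {X : Type*} [MeasurableSpace X]

/-- The subspace `L_∞ ∩ L_2` of `L_2`; it is `L_∞` if the measure is finite. -/
def LInfty (μ : Measure X) : Submodule ℂ (Lp ℂ 2 μ) where
  carrier := {f | MemLp (f : X → ℂ) ∞ μ}
  add_mem' := fun {f g} hf hg => (memLp_congr_ae (Lp.coeFn_add f g)).2 (MemLp.add hf hg)
  zero_mem' := (memLp_congr_ae (Lp.coeFn_zero ℂ 2 μ)).2 MemLp.zero
  smul_mem' := fun c f hf => (memLp_congr_ae (Lp.coeFn_smul c f)).2 (MemLp.const_smul hf c)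

/-- The constant function `1` as an element of `L_2`. -/
def one (μ : Measure X) [IsFiniteMeasure μ] : Lp ℂ 2 μ :=
  (memLp_const (1 : ℂ)).toLp (fun _ : X => (1 : ℂ))

/-- `U` leaves `L_∞` invariant. -/
def PreservesLInfty {μ : Measure X} (U : ℝ → Lp ℂ 2 μ →L[ℂ] Lp ℂ 2 μ) : Prop :=
  ∀ t : ℝ, ∀ f ∈ LInfty μ, U t f ∈ LInfty μ

/-- For each `t` there are a map `T : X → X` and a function `ψ : X → ℂ` such that
`U t f = ψ · (f ∘ T)` for all `f ∈ L_2`. The identity is required for every square-integrable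
function `f`, that is, whichever representative of a class in `L_2` is composed with `T`. -/
def IsWeightedNonsingular {μ : Measure X} (U : ℝ → Lp ℂ 2 μ →L[ℂ] Lp ℂ 2 μ) : Prop :=
  ∀ t : ℝ, ∃ (T : X → X) (ψ : X → ℂ), ∀ (f : X → ℂ) (hf : MemLp f 2 μ),
    ∀ᵐ x ∂μ, U t (hf.toLp f) x = ψ x * f (T x)

/-- The linear subspace `D` of `L_2` is an algebra: it is closed under the
(almost everywhere pointwise) product. -/
def IsAlgebra {μ : Measure X} (D : Submodule ℂ (Lp ℂ 2 μ)) : Prop :=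
  ∀ f ∈ D, ∀ g ∈ D, ∃ h ∈ D, ∀ᵐ x ∂μ, h x = f x * g x

/-- The operator `B` satisfies `B (f g) = (B f) g + f (B g)` for all `f, g ∈ D`,
where `D` is a subspace of the domain of `B` that is an algebra (`h` is the product `f g`). -/
def IsDerivationOn {μ : Measure X} (B : Lp ℂ 2 μ →ₗ.[ℂ] Lp ℂ 2 μ)
    (D : Submodule ℂ (Lp ℂ 2 μ)) : Prop :=
  D ≤ B.domain ∧ IsAlgebra D ∧
    ∀ f g h : B.domain, (f : Lp ℂ 2 μ) ∈ D → (g : Lp ℂ 2 μ) ∈ D → (h : Lp ℂ 2 μ) ∈ D →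
      (∀ᵐ x ∂μ, (h : Lp ℂ 2 μ) x = (f : Lp ℂ 2 μ) x * (g : Lp ℂ 2 μ) x) →
      ∀ᵐ x ∂μ, B h x = B f x * (g : Lp ℂ 2 μ) x + (f : Lp ℂ 2 μ) x * B g x

end L2

end WeightedKoopman

end

/-! Both directions say that `V` acts by composition, `V t f = f ∘ T t`, and that this amounts to `V
t` being unital and multiplicative on `L_∞`.

From (i): `f = 1` identifies the weight as `U t 1`, and `f = U (-t) 1` gives `1 = U t 1 · (f ∘ T)`,
so `1 / U t 1` is bounded. Then `V t` is composition with `T`, hence multiplicative and contractive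
in the `L_∞` norm, and differentiating `V t (f g) = V t f · V t g` at `0` gives the derivation rule.
Strong continuity of `V` is checked on `L_∞` and extended by a Baire argument
(`isC0Group_of_dense`).

From (ii): for `f, g` in the algebra, `s ↦ V (-s) (V s f · V s g)` has derivative zero, so `V t` is
multiplicative there (`IsC0Group.map_mul_of_mem_domain`), and on `L_∞` by approximation with time
averages (`IsC0Group.map_mul`). Products are controlled by an `L_∞` bound uniform for small `t`,
which Baire's theorem yields because `L_∞` balls are complete in the `L_2` metric. A unital
multiplicative `V t` sends indicators to indicators and respects countable unions, so on a standard
Borel space it comes from a point map (`exists_map_mapsInd`). -/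

namespace WeightedKoopman

/-! ### `L_∞` balls inside `L_2` and the pointwise product. -/

section Bounded

variable {X : Type*} [MeasurableSpace X] {μ : Measure X}

/-- The elements of `L_2` that are bounded by `M` almost everywhere. -/
def bddBall (μ : Measure X) (M : ℝ) : Set (Lp ℂ 2 μ) := {f | ∀ᵐ x ∂μ, ‖f x‖ ≤ M}

theorem mem_LInfty_iff {f : Lp ℂ 2 μ} : f ∈ LInfty μ ↔ ∃ M, 0 < M ∧ f ∈ bddBall μ M := by
  constructor
  · intro h
    refine ⟨lpNorm f ∞ μ + 1, by linarith [lpNorm_nonneg (f := f) (p := ∞) (μ := μ)], ?_⟩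
    filter_upwards [ae_le_lpNorm_exponent_top h] with x hx
    linarith
  · rintro ⟨M, -, h⟩
    exact memLp_top_of_bound (Lp.aestronglyMeasurable f) M h

theorem mem_LInfty_of_mem_bddBall {f : Lp ℂ 2 μ} {M : ℝ} (h : f ∈ bddBall μ M) :
    f ∈ LInfty μ :=
  memLp_top_of_bound (Lp.aestronglyMeasurable f) M h

theorem bddBall_mono {M N : ℝ} (h : M ≤ N) : bddBall μ M ⊆ bddBall μ N := by
  intro f (hf : ∀ᵐ x ∂μ, ‖f x‖ ≤ M)
  exact hf.mono fun x hx => hx.trans h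

theorem zero_mem_bddBall {M : ℝ} (hM : 0 ≤ M) : (0 : Lp ℂ 2 μ) ∈ bddBall μ M := by
  filter_upwards [Lp.coeFn_zero ℂ 2 μ] with x hx
  rw [hx]
  simpa using hM

theorem add_mem_bddBall {f g : Lp ℂ 2 μ} {M N : ℝ} (hf : f ∈ bddBall μ M)
    (hg : g ∈ bddBall μ N) : f + g ∈ bddBall μ (M + N) := by
  filter_upwards [hf, hg, Lp.coeFn_add f g] with x h1 h2 h
  rw [h]
  exact (norm_add_le _ _).trans (add_le_add h1 h2)

theorem sub_mem_bddBall {f g : Lp ℂ 2 μ} {M N : ℝ} (hf : f ∈ bddBall μ M)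
    (hg : g ∈ bddBall μ N) : f - g ∈ bddBall μ (M + N) := by
  filter_upwards [hf, hg, Lp.coeFn_sub f g] with x h1 h2 h
  rw [h]
  exact (norm_sub_le _ _).trans (add_le_add h1 h2)

theorem smul_mem_bddBall {f : Lp ℂ 2 μ} {M : ℝ} (c : ℂ) (hf : f ∈ bddBall μ M) :
    c • f ∈ bddBall μ (‖c‖ * M) := by
  filter_upwards [hf, Lp.coeFn_smul c f] with x h1 h
  rw [h, Pi.smul_apply, norm_smul]
  gcongr

theorem convex_bddBall (M : ℝ) : Convex ℝ (bddBall μ M) := by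
  intro f hf g hg a b ha hb hab
  filter_upwards [hf, hg, Lp.coeFn_add (a • f) (b • g), Lp.coeFn_smul a f, Lp.coeFn_smul b g]
    with x h1 h2 h3 h4 h5
  rw [h3, Pi.add_apply, h4, h5, Pi.smul_apply, Pi.smul_apply]
  calc ‖a • f x + b • g x‖ ≤ ‖a • f x‖ + ‖b • g x‖ := norm_add_le _ _
    _ = a * ‖f x‖ + b * ‖g x‖ := by
      rw [norm_smul, norm_smul, Real.norm_of_nonneg ha, Real.norm_of_nonneg hb]
    _ ≤ a * M + b * M := by gcongr
    _ = M := by rw [← add_mul, hab, one_mul]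

theorem exists_subseq_tendsto_ae {f : ℕ → Lp ℂ 2 μ} {g : Lp ℂ 2 μ}
    (h : Tendsto f atTop (𝓝 g)) :
    ∃ n : ℕ → ℕ, StrictMono n ∧ ∀ᵐ x ∂μ, Tendsto (fun i => f (n i) x) atTop (𝓝 (g x)) :=
  (tendstoInMeasure_of_tendsto_Lp h).exists_seq_tendsto_ae

/-- An `L_2` limit is an a.e. limit along a subsequence. Closedness makes the ball complete for the
`L_2` metric, so Baire's theorem applies to it. -/
theorem isClosed_bddBall (M : ℝ) : IsClosed (bddBall μ M) := by
  refine IsSeqClosed.isClosed fun f g hf h => ?_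
  obtain ⟨n, -, hn⟩ := exists_subseq_tendsto_ae h
  filter_upwards [hn, ae_all_iff.2 hf] with x hx hb
  exact le_of_tendsto' hx.norm fun i => hb (n i)

theorem exists_mem_LInfty_norm_sub_lt (f : Lp ℂ 2 μ) {ε : ℝ} (hε : 0 < ε) :
    ∃ g ∈ LInfty μ, ‖f - g‖ < ε := by
  obtain ⟨s, hs⟩ := (Lp.simpleFunc.denseRange (E := ℂ) (μ := μ) (p := 2)
    (by norm_num)).exists_dist_lt f hε
  refine ⟨s, ?_, by rwa [← dist_eq_norm]⟩
  obtain ⟨C, hC⟩ := (Lp.simpleFunc.toSimpleFunc s).exists_forall_norm_le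
  refine mem_LInfty_of_mem_bddBall (M := C) ?_
  filter_upwards [Lp.simpleFunc.toSimpleFunc_eq_toFun s] with x hx
  rw [← hx]
  exact hC x

open Classical in
/-- The pointwise product of two elements of `L_2`, or `0` if the product is not in `L_2`. -/
noncomputable def mul (f g : Lp ℂ 2 μ) : Lp ℂ 2 μ :=
  if h : MemLp (fun x => f x * g x) 2 μ then h.toLp _ else 0

-- No boundedness is needed, since the default value `0` is symmetric too. Results with the bounded
-- factor on the left thus transfer to the right.
open Classical in
theorem mul_comm' (f g : Lp ℂ 2 μ) : mul f g = mul g f := by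
  have h : (fun x => f x * g x) = fun x => g x * f x := funext fun x => mul_comm _ _
  exact congrArg (fun u : X → ℂ => if h : MemLp u 2 μ then h.toLp u else 0) h

theorem coeFn_mul {f g : Lp ℂ 2 μ} (hf : f ∈ LInfty μ) :
    ∀ᵐ x ∂μ, mul f g x = f x * g x := by
  obtain ⟨M, -, hM⟩ := mem_LInfty_iff.1 hf
  have h : MemLp (fun x => f x * g x) 2 μ := by
    refine (Lp.memLp g).of_le_mul (c := M)
      ((Lp.aestronglyMeasurable f).mul (Lp.aestronglyMeasurable g)) ?_
    filter_upwards [hM] with x hx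
    rw [norm_mul]
    gcongr
  rw [mul, dif_pos h]
  exact h.coeFn_toLp

theorem norm_mul_le' {f g : Lp ℂ 2 μ} {M : ℝ} (hf : f ∈ bddBall μ M) :
    ‖mul f g‖ ≤ M * ‖g‖ := by
  refine Lp.norm_le_mul_norm_of_ae_le_mul ?_
  filter_upwards [hf, coeFn_mul (g := g) (mem_LInfty_of_mem_bddBall hf)] with x h1 h2
  rw [h2, norm_mul]
  gcongr

theorem mul_mem_bddBall {f g : Lp ℂ 2 μ} {M N : ℝ} (hf : f ∈ bddBall μ M)
    (hg : g ∈ bddBall μ N) : mul f g ∈ bddBall μ (M * N) := by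
  filter_upwards [hf, hg, coeFn_mul (g := g) (mem_LInfty_of_mem_bddBall hf)] with x h1 h2 h
  rw [h, norm_mul]
  exact mul_le_mul h1 h2 (norm_nonneg _) ((norm_nonneg _).trans h1)

theorem mul_mem_LInfty {f g : Lp ℂ 2 μ} (hf : f ∈ LInfty μ) (hg : g ∈ LInfty μ) :
    mul f g ∈ LInfty μ := by
  obtain ⟨M, -, hM⟩ := mem_LInfty_iff.1 hf
  obtain ⟨N, -, hN⟩ := mem_LInfty_iff.1 hg
  exact mem_LInfty_of_mem_bddBall (mul_mem_bddBall hM hN)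

theorem eq_mul_of_ae {f g h : Lp ℂ 2 μ} (hf : f ∈ LInfty μ)
    (hh : ∀ᵐ x ∂μ, h x = f x * g x) : h = mul f g := by
  refine Lp.ext ?_
  filter_upwards [hh, coeFn_mul (g := g) hf] with x h1 h2
  rw [h1, h2]

theorem mul_add' {f : Lp ℂ 2 μ} (hf : f ∈ LInfty μ) (g h : Lp ℂ 2 μ) :
    mul f (g + h) = mul f g + mul f h := by
  refine (eq_mul_of_ae hf ?_).symm
  filter_upwards [coeFn_mul (g := g) hf, coeFn_mul (g := h) hf, Lp.coeFn_add g h,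
    Lp.coeFn_add (mul f g) (mul f h)] with x h1 h2 h3 h4
  rw [h4, Pi.add_apply, h1, h2, h3, Pi.add_apply, mul_add]

theorem mul_smul' {f : Lp ℂ 2 μ} (hf : f ∈ LInfty μ) (c : ℂ) (g : Lp ℂ 2 μ) :
    mul f (c • g) = c • mul f g := by
  refine (eq_mul_of_ae hf ?_).symm
  filter_upwards [coeFn_mul (g := g) hf, Lp.coeFn_smul c g,
    Lp.coeFn_smul c (mul f g)] with x h1 h2 h3
  rw [h3, Pi.smul_apply, h1, h2, Pi.smul_apply, smul_eq_mul, smul_eq_mul, mul_left_comm]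

/-- Multiplication by a bounded function, as a bounded operator on `L_2`. -/
noncomputable def mulL (f : Lp ℂ 2 μ) (hf : f ∈ LInfty μ) : Lp ℂ 2 μ →L[ℂ] Lp ℂ 2 μ :=
  LinearMap.mkContinuousOfExistsBound
    { toFun := mul f, map_add' := mul_add' hf, map_smul' := mul_smul' hf }
    (by
      obtain ⟨M, -, hM⟩ := mem_LInfty_iff.1 hf
      exact ⟨M, fun g => norm_mul_le' hM⟩)

theorem mulL_apply (f : Lp ℂ 2 μ) (hf : f ∈ LInfty μ) (g : Lp ℂ 2 μ) :
    mulL f hf g = mul f g := rfl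

theorem mul_sub' {f : Lp ℂ 2 μ} (hf : f ∈ LInfty μ) (g h : Lp ℂ 2 μ) :
    mul f (g - h) = mul f g - mul f h := (mulL f hf).map_sub g h

theorem sub_mul' {g : Lp ℂ 2 μ} (hg : g ∈ LInfty μ) (f h : Lp ℂ 2 μ) :
    mul (f - h) g = mul f g - mul h g := by
  rw [mul_comm', mul_sub' hg, mul_comm' g, mul_comm' g]

theorem sub_mul_of_bounded {f h : Lp ℂ 2 μ} (hf : f ∈ LInfty μ) (hh : h ∈ LInfty μ)
    (g : Lp ℂ 2 μ) : mul (f - h) g = mul f g - mul h g := by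
  refine (eq_mul_of_ae ((LInfty μ).sub_mem hf hh) ?_).symm
  filter_upwards [coeFn_mul (g := g) hf, coeFn_mul (g := g) hh, Lp.coeFn_sub f h,
    Lp.coeFn_sub (mul f g) (mul h g)] with x h1 h2 h3 h4
  rw [h4, Pi.sub_apply, h1, h2, h3, Pi.sub_apply, sub_mul]

theorem smul_mul' {g : Lp ℂ 2 μ} (hg : g ∈ LInfty μ) (c : ℂ) (f : Lp ℂ 2 μ) :
    mul (c • f) g = c • mul f g := by
  rw [mul_comm', mul_smul' hg, mul_comm' g]

/-- As `a` is only in `L_2`, it is split into a bounded part `c` and a part small in `L_2`, which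
the uniform bound on `b` controls. -/
theorem tendsto_mul_zero {ι : Type*} {l : Filter ι} {b : ι → Lp ℂ 2 μ} {M : ℝ} (hM : 0 < M)
    (a : Lp ℂ 2 μ) (hb : ∀ᶠ i in l, b i ∈ bddBall μ M) (h : Tendsto b l (𝓝 0)) :
    Tendsto (fun i => mul (b i) a) l (𝓝 0) := by
  rw [Metric.tendsto_nhds]
  intro ε hε
  obtain ⟨c, hc, hac⟩ := exists_mem_LInfty_norm_sub_lt a (ε := ε / (2 * M)) (by positivity)
  have h2 : Tendsto (fun i => mul c (b i)) l (𝓝 0) := by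
    have := ((mulL c hc).continuous.tendsto 0).comp h
    rwa [map_zero] at this
  filter_upwards [Metric.tendsto_nhds.1 h2 (ε / 2) (by positivity), hb] with i hi hbi
  rw [dist_zero_right] at hi ⊢
  have h3 : mul (b i) a = mul (b i) (a - c) + mul c (b i) := by
    rw [mul_sub' (mem_LInfty_of_mem_bddBall hbi), mul_comm' c]
    abel
  rw [h3]
  calc _ ≤ ‖mul (b i) (a - c)‖ + ‖mul c (b i)‖ := norm_add_le _ _
    _ < M * ‖a - c‖ + ε / 2 := by
      have := norm_mul_le' (g := a - c) hbi
      linarith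
    _ ≤ M * (ε / (2 * M)) + ε / 2 := by gcongr
    _ = ε := by field_simp; ring

theorem tendsto_mul {ι : Type*} {l : Filter ι} [l.NeBot] {a b : ι → Lp ℂ 2 μ}
    {a₀ b₀ : Lp ℂ 2 μ} {M : ℝ} (hM : 0 < M) (hb : ∀ᶠ i in l, b i ∈ bddBall μ M)
    (ha : Tendsto a l (𝓝 a₀)) (hb' : Tendsto b l (𝓝 b₀)) :
    Tendsto (fun i => mul (a i) (b i)) l (𝓝 (mul a₀ b₀)) := by
  have hb₀ : b₀ ∈ bddBall μ M := (isClosed_bddBall M).mem_of_tendsto hb' hb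
  have h1 : Tendsto (fun i => mul (b i) (a i - a₀)) l (𝓝 0) := by
    have h : Tendsto (fun i => M * ‖a i - a₀‖) l (𝓝 0) := by
      simpa using (tendsto_iff_norm_sub_tendsto_zero.1 ha).const_mul M
    refine squeeze_zero_norm' ?_ h
    filter_upwards [hb] with i hi using norm_mul_le' hi
  have h2 : Tendsto (fun i => mul (b i - b₀) a₀) l (𝓝 0) := by
    refine tendsto_mul_zero (M := M + M) (by positivity) a₀ ?_ ?_
    · filter_upwards [hb] with i hi using sub_mem_bddBall hi hb₀
    · simpa using hb'.sub_const b₀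
  have h3 := (h1.add h2).add_const (mul a₀ b₀)
  rw [add_zero, zero_add] at h3
  refine h3.congr' ?_
  filter_upwards [hb] with i hi
  have hi' := mem_LInfty_of_mem_bddBall hi
  rw [mul_sub' hi', sub_mul_of_bounded hi' (mem_LInfty_of_mem_bddBall hb₀), mul_comm' (a i),
    mul_comm' a₀]
  abel

/-- The bound has to hold everywhere because `r` will be composed with a map not yet known to pull
null sets back to null sets. -/
theorem exists_bounded_representative {f : Lp ℂ 2 μ} {M : ℝ} (hM : 0 < M)
    (hf : f ∈ bddBall μ M) : ∃ r : X → ℂ, f =ᵐ[μ] r ∧ ∀ x, ‖r x‖ ≤ M := by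
  classical
  refine ⟨fun x => if ‖f x‖ ≤ M then f x else 0, ?_, fun x => ?_⟩
  · filter_upwards [hf] with x hx
    rw [if_pos hx]
  · dsimp only
    split_ifs with hx
    · exact hx
    · simpa using hM.le

theorem aestronglyMeasurable_one_div (f : Lp ℂ 2 μ) :
    AEStronglyMeasurable (fun x => 1 / f x) μ :=
  ((Lp.aestronglyMeasurable f).aemeasurable.const_div 1).aestronglyMeasurable

end Bounded

section One

variable {X : Type*} [MeasurableSpace X] {μ : Measure X} [IsFiniteMeasure μ]

theorem coeFn_one : ∀ᵐ x ∂μ, one μ x = 1 :=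
  (memLp_const (1 : ℂ)).coeFn_toLp

theorem one_mem_LInfty : one μ ∈ LInfty μ := by
  refine mem_LInfty_of_mem_bddBall (M := 1) ?_
  filter_upwards [coeFn_one (μ := μ)] with x hx
  rw [hx, norm_one]

theorem mul_one' {f : Lp ℂ 2 μ} (hf : f ∈ LInfty μ) : mul f (one μ) = f := by
  refine (eq_mul_of_ae hf ?_).symm
  filter_upwards [coeFn_one (μ := μ)] with x hx
  rw [hx, mul_one]

theorem norm_le_norm_one {f : Lp ℂ 2 μ} (hf : f ∈ bddBall μ 1) : ‖f‖ ≤ ‖one μ‖ := by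
  refine Lp.norm_le_norm_of_ae_le ?_
  filter_upwards [hf, coeFn_one (μ := μ)] with x h1 h2
  rwa [h2, norm_one]

end One

/-! ### General `C_0`-groups: bounds, continuity from a dense set, time averages. -/

section Groups

variable {E : Type*} [NormedAddCommGroup E] [NormedSpace ℂ E] {V : ℝ → E →L[ℂ] E}

theorem IsC0Group.apply_add (hV : IsC0Group V) (s t : ℝ) (f : E) :
    V (s + t) f = V s (V t f) := by
  rw [hV.map_add]; rfl

theorem IsC0Group.apply_zero (hV : IsC0Group V) (f : E) : V 0 f = f := by
  rw [hV.map_zero]; rfl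

theorem IsC0Group.apply_neg (hV : IsC0Group V) (t : ℝ) (f : E) : V t (V (-t) f) = f := by
  rw [← hV.apply_add, add_neg_cancel, hV.apply_zero]

theorem IsC0Group.exists_bound [CompleteSpace E] (hV : IsC0Group V) (R : ℝ) :
    ∃ C, 0 < C ∧ ∀ t, |t| ≤ R → ‖V t‖ ≤ C := by
  obtain ⟨C, hC⟩ := banach_steinhaus (g := fun t : Set.Icc (-R) R => V t) fun f => by
    obtain ⟨C, hC⟩ := (isCompact_Icc (a := -R) (b := R)).exists_bound_of_continuousOn
      (hV.continuous_orbit f).continuousOn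
    exact ⟨C, fun t => hC t t.2⟩
  exact ⟨max C 1, by positivity, fun t ht => (hC ⟨t, abs_le.1 ht⟩).trans (le_max_left _ _)⟩

theorem tendsto_apply_of_bound {ι : Type*} {l : Filter ι} {W : ι → E →L[ℂ] E} {C : ℝ}
    (hC : ∀ᶠ i in l, ‖W i‖ ≤ C) {f : ι → E} {f₀ g : E} (hf : Tendsto f l (𝓝 f₀))
    (hW : Tendsto (fun i => W i f₀) l (𝓝 g)) : Tendsto (fun i => W i (f i)) l (𝓝 g) := by
  have h : Tendsto (fun i => W i (f i - f₀)) l (𝓝 0) := by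
    have h1 : Tendsto (fun i => C * ‖f i - f₀‖) l (𝓝 0) := by
      simpa using (tendsto_iff_norm_sub_tendsto_zero.1 hf).const_mul C
    refine squeeze_zero_norm' ?_ h1
    filter_upwards [hC] with i hi using (W i).le_of_opNorm_le hi _
  simpa using h.add hW

theorem IsC0Group.continuous_uncurry [CompleteSpace E] (hV : IsC0Group V) :
    Continuous fun p : ℝ × E => V p.1 p.2 := by
  refine continuous_iff_continuousAt.2 fun ⟨t, f⟩ => ?_
  obtain ⟨C, -, hC⟩ := hV.exists_bound (|t| + 1)
  refine tendsto_apply_of_bound (C := C) ?_ continuous_snd.continuousAt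
    ((hV.continuous_orbit f).comp continuous_fst).continuousAt
  have h : Tendsto (fun p : ℝ × E => |p.1|) (𝓝 (t, f)) (𝓝 |t|) :=
    (continuous_abs.comp continuous_fst).continuousAt
  filter_upwards [h.eventually (gt_mem_nhds (lt_add_one |t|))] with p hp using hC _ hp.le

/-- A one-parameter group of bounded operators is strongly continuous if its orbits are continuous
at `0` on a dense set. -/
theorem isC0Group_of_dense (h0 : V 0 = ContinuousLinearMap.id ℂ E)
    (hadd : ∀ s t, V (s + t) = (V s).comp (V t)) {D : Set E} (hD : Dense D)
    (hc : ∀ f ∈ D, Tendsto (fun t => V t f) (𝓝 0) (𝓝 f)) : IsC0Group V := by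
  have hadd' : ∀ s t f, V (s + t) f = V s (V t f) := fun s t f => by rw [hadd]; rfl
  have translate : ∀ f, Tendsto (fun t => V t f) (𝓝 0) (𝓝 f) →
      Continuous fun t => V t f := fun f hf => by
    refine continuous_iff_continuousAt.2 fun t => ?_
    have h1 : Tendsto (fun s => s - t) (𝓝 t) (𝓝 0) := by
      simpa using (continuous_sub_right t).tendsto t
    have h2 := ((V t).continuous.tendsto f).comp (hf.comp h1)
    refine h2.congr fun s => ?_
    simp only [Function.comp_apply]
    rw [← hadd', add_sub_cancel]
  -- Baire on the parameter line: only orbits through `D` are known to be continuous, which suffices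
  -- for the level sets to be closed. The bound near `t₀` is moved to `0` by composing with `V
  -- (-t₀)`.
  have hbound : ∃ C, ∀ᶠ t in 𝓝 (0 : ℝ), ‖V t‖ ≤ C := by
    obtain ⟨n, t₀, ht₀⟩ := nonempty_interior_of_iUnion_of_closed
      (f := fun n : ℕ => {t : ℝ | ∀ f ∈ D, ‖V t f‖ ≤ n * ‖f‖})
      (fun n => by
        simp only [Set.ofPred_forall]
        exact isClosed_iInter fun f => isClosed_iInter fun hf =>
          isClosed_le (translate f (hc f hf)).norm continuous_const)
      (Set.eq_univ_of_forall fun t => by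
        obtain ⟨n, hn⟩ := exists_nat_ge ‖V t‖
        exact Set.mem_iUnion.2 ⟨n, fun f _ => (V t).le_of_opNorm_le hn f⟩)
    refine ⟨n * ‖V (-t₀)‖, ?_⟩
    have h1 : Tendsto (fun s => t₀ + s) (𝓝 0) (𝓝 t₀) := by
      simpa using (continuous_const_add t₀).tendsto 0
    filter_upwards [h1.eventually (mem_interior_iff_mem_nhds.1 ht₀)] with s hs
    have h2 : ‖V (t₀ + s)‖ ≤ n := by
      refine ContinuousLinearMap.opNorm_le_bound _ (Nat.cast_nonneg n) fun f => ?_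
      refine hD.induction (P := fun f => ‖V (t₀ + s) f‖ ≤ n * ‖f‖) (fun f hf => hs f hf) ?_ f
      exact isClosed_le (V (t₀ + s)).continuous.norm (continuous_const.mul continuous_norm)
    have h3 : V s = (V (t₀ + s)).comp (V (-t₀)) := by
      rw [← hadd]; congr 1; ring
    rw [h3]
    refine (ContinuousLinearMap.opNorm_comp_le _ _).trans ?_
    gcongr
  obtain ⟨C, hC⟩ := hbound
  have hC0 : 0 ≤ C := by
    obtain ⟨t, ht⟩ := hC.exists
    exact (norm_nonneg _).trans ht
  refine ⟨h0, hadd, fun f => translate f ?_⟩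
  rw [Metric.tendsto_nhds]
  intro ε hε
  obtain ⟨g, hg, hfg⟩ := hD.exists_dist_lt f (ε := ε / (2 * (C + 1))) (by positivity)
  filter_upwards [hC, Metric.tendsto_nhds.1 (hc g hg) (ε / 2) (by positivity)] with t ht hgt
  rw [dist_eq_norm] at hfg hgt ⊢
  have h : V t f - f = V t (f - g) + (V t g - g) - (f - g) := by
    rw [map_sub]; abel
  rw [h]
  calc _ ≤ ‖V t (f - g)‖ + ‖V t g - g‖ + ‖f - g‖ :=
        (norm_sub_le _ _).trans (add_le_add_left (norm_add_le _ _) _)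
    _ < C * ‖f - g‖ + ε / 2 + ‖f - g‖ := by
        have := (V t).le_of_opNorm_le ht (f - g)
        linarith
    _ = (C + 1) * ‖f - g‖ + ε / 2 := by ring
    _ ≤ (C + 1) * (ε / (2 * (C + 1))) + ε / 2 := by gcongr
    _ = ε := by field_simp; ring

theorem HasOrbitDeriv.apply (hV : IsC0Group V) {f g : E} (h : HasOrbitDeriv V f g) (s : ℝ) :
    HasOrbitDeriv V (V s f) (V s g) := by
  refine (((V s).continuous.tendsto g).comp h).congr fun t => ?_
  simp only [Function.comp_apply, map_smul, map_sub]
  rw [← hV.apply_add, ← hV.apply_add, add_comm]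

theorem IsC0Group.tendsto_punctured (hV : IsC0Group V) (f : E) :
    Tendsto (fun t => V t f) (𝓝[≠] 0) (𝓝 f) := by
  have h := (hV.continuous_orbit f).tendsto 0
  rw [hV.apply_zero] at h
  exact h.mono_left nhdsWithin_le_nhds

theorem hasOrbitDeriv_of_hasDerivAt {f g h : E} {u : ℝ → E} (hu : ∀ t, u t = V t f - h)
    (h0 : V 0 f = f) (hd : HasDerivAt u g (0 : ℝ)) : HasOrbitDeriv V f g := by
  rw [hasDerivAt_iff_tendsto_slope_zero] at hd
  refine hd.congr fun t => ?_
  rw [zero_add, hu, hu, h0, sub_sub_sub_cancel_right, ← Complex.ofReal_inv, Complex.coe_smul]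

/-- Time averages along an orbit of a `C_0`-group are in the domain of the generator. -/
theorem IsC0Group.hasOrbitDeriv_integral [CompleteSpace E] (hV : IsC0Group V) (f : E) (s : ℝ) :
    HasOrbitDeriv V (∫ r in (0 : ℝ)..s, V r f) (V s f - f) := by
  have hc := hV.continuous_orbit f
  have hI : ∀ a b, IntervalIntegrable (fun r => V r f) volume a b := hc.intervalIntegrable
  have hG : ∀ t, HasDerivAt (fun u => ∫ r in (0 : ℝ)..u, V r f) (V t f) t := fun t =>
    (hc.integral_hasStrictDerivAt 0 t).hasDerivAt
  refine hasOrbitDeriv_of_hasDerivAt (h := 0)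
    (u := fun t => (∫ r in (0 : ℝ)..(s + t), V r f) - ∫ r in (0 : ℝ)..t, V r f) (fun t => ?_)
    (hV.apply_zero _) ?_
  -- `V t` shifts the interval of integration from `[0, s]` to `[t, s + t]`.
  · rw [sub_zero, ← ContinuousLinearMap.intervalIntegral_comp_comm _ (hI _ _)]
    simp only [← hV.apply_add]
    rw [intervalIntegral.integral_comp_add_left (fun r => V r f) t, add_zero, add_comm s t,
      intervalIntegral.integral_interval_sub_left (hI _ _) (hI _ _)]
  · have h1 : HasDerivAt (fun t => ∫ r in (0 : ℝ)..(s + t), V r f) (V s f) 0 := by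
      simpa using HasDerivAt.comp_const_add s 0 (hG (s + 0))
    have h2 := hG 0
    rw [hV.apply_zero] at h2
    exact h1.sub h2

end Groups

/-! ### Product rule along orbits. -/

section Orbits

variable {X : Type*} [MeasurableSpace X] {μ : Measure X} {V : ℝ → Lp ℂ 2 μ →L[ℂ] Lp ℂ 2 μ}

/-- Leibniz splitting `(V t F - F) · V t G + F · (V t G - G)`. Multiplicativity of `V` is not
assumed, so this serves both directions. -/
theorem tendsto_mul_orbit (hV : IsC0Group V) {F F' G G' : Lp ℂ 2 μ}
    (hF : HasOrbitDeriv V F F') (hG : HasOrbitDeriv V G G') (hFb : F ∈ LInfty μ) {M : ℝ}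
    (hM : 0 < M) (hGb : ∀ᶠ t in 𝓝[≠] (0 : ℝ), V t G ∈ bddBall μ M) :
    Tendsto (fun t : ℝ => ((t : ℂ)⁻¹) • (mul (V t F) (V t G) - mul F G)) (𝓝[≠] 0)
      (𝓝 (mul F' G + mul F G')) := by
  have h1 := tendsto_mul hM hGb hF (hV.tendsto_punctured G)
  have h2 := ((mulL F hFb).continuous.tendsto G').comp hG
  refine (h1.add h2).congr' ?_
  filter_upwards [hGb] with t ht
  have ht' := mem_LInfty_of_mem_bddBall ht
  simp only [Function.comp_apply]
  rw [mulL_apply, smul_mul' ht', mul_smul' hFb, sub_mul' ht', mul_sub' hFb, ← smul_add,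
    sub_add_sub_cancel]

end Orbits

section Derivation

variable {X : Type*} [MeasurableSpace X] {μ : Measure X} {V : ℝ → Lp ℂ 2 μ →L[ℂ] Lp ℂ 2 μ}

theorem generator_eq_of_hasOrbitDeriv {E : Type*} [NormedAddCommGroup E] [NormedSpace ℂ E]
    {V : ℝ → E →L[ℂ] E} {g : E} (f : (generator V).domain) (h : HasOrbitDeriv V (f : E) g) :
    generator V f = g :=
  (generator_spec V f).unique h

theorem hasOrbitDeriv_mul (hV : IsC0Group V)
    (hmul : ∀ t, ∀ f ∈ LInfty μ, ∀ g ∈ LInfty μ, V t (mul f g) = mul (V t f) (V t g))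
    (hb : ∀ t M, 0 < M → ∀ f ∈ bddBall μ M, V t f ∈ bddBall μ M)
    {f f' g g' : Lp ℂ 2 μ} (hf : HasOrbitDeriv V f f') (hg : HasOrbitDeriv V g g')
    (hfb : f ∈ LInfty μ) (hgb : g ∈ LInfty μ) :
    HasOrbitDeriv V (mul f g) (mul f' g + mul f g') := by
  obtain ⟨M, hM, hgM⟩ := mem_LInfty_iff.1 hgb
  refine (tendsto_mul_orbit hV hf hg hfb hM
    (Eventually.of_forall fun t => hb t M hM g hgM)).congr fun t => ?_
  rw [hmul t f hfb g hgb]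

theorem isAlgebra_and_isDerivationOn (hV : IsC0Group V)
    (hmul : ∀ t, ∀ f ∈ LInfty μ, ∀ g ∈ LInfty μ, V t (mul f g) = mul (V t f) (V t g))
    (hb : ∀ t M, 0 < M → ∀ f ∈ bddBall μ M, V t f ∈ bddBall μ M) :
    IsAlgebra ((generator V).domain ⊓ LInfty μ) ∧
      IsDerivationOn (generator V) ((generator V).domain ⊓ LInfty μ) := by
  have halg : IsAlgebra ((generator V).domain ⊓ LInfty μ) := by
    rintro f ⟨⟨f', hf⟩, hfb⟩ g ⟨⟨g', hg⟩, hgb⟩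
    exact ⟨mul f g, ⟨⟨_, hasOrbitDeriv_mul hV hmul hb hf hg hfb hgb⟩, mul_mem_LInfty hfb hgb⟩,
      coeFn_mul hfb⟩
  refine ⟨halg, inf_le_left, halg, fun f g h hf hg _ hfg => ?_⟩
  have h1 := hasOrbitDeriv_mul hV hmul hb (generator_spec V f) (generator_spec V g) hf.2 hg.2
  rw [← eq_mul_of_ae hf.2 hfg] at h1
  rw [generator_eq_of_hasOrbitDeriv h h1]
  have h2 := coeFn_mul (g := generator V f) hg.2
  rw [mul_comm'] at h2
  filter_upwards [Lp.coeFn_add (mul (generator V f) g) (mul (f : Lp ℂ 2 μ) (generator V g)),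
    h2, coeFn_mul (g := generator V g) hf.2] with x h3 h4 h5
  rw [h3, Pi.add_apply, h4, h5, mul_comm (g.1 x)]

end Derivation

/-! ### From weighted composition operators to the group `V`. -/

section Weighted

variable {X : Type*} [MeasurableSpace X] {μ : Measure X} [IsFiniteMeasure μ]
  {U : ℝ → Lp ℂ 2 μ →L[ℂ] Lp ℂ 2 μ}

theorem IsWeightedNonsingular.exists_map (h : IsWeightedNonsingular U) (t : ℝ) :
    ∃ T : X → X, ∀ (f : Lp ℂ 2 μ) (r : X → ℂ), f =ᵐ[μ] r →
      ∀ᵐ x ∂μ, U t f x = U t (one μ) x * r (T x) := by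
  obtain ⟨T, ψ, hT⟩ := h t
  refine ⟨T, fun f r hr => ?_⟩
  have hrm : MemLp r 2 μ := (memLp_congr_ae hr).1 (Lp.memLp f)
  have hrf : hrm.toLp r = f := Lp.ext (hrm.coeFn_toLp.trans hr.symm)
  filter_upwards [hrf ▸ hT r hrm, hT (fun _ => 1) (memLp_const 1)] with x h1 h2
  change U t (one μ) x = _ at h2
  rw [h1, h2, mul_one]

/-- The formula for `U t` applied to the bounded function `U (-t) 1` exhibits the inverse of the
weight as a bounded function composed with `T`. -/
theorem IsWeightedNonsingular.ne_zero_and_memLp (h : IsWeightedNonsingular U)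
    (hU : IsC0Group U) (hInf : PreservesLInfty U) (t : ℝ) :
    (∀ᵐ x ∂μ, U t (one μ) x ≠ 0) ∧ MemLp (fun x => 1 / U t (one μ) x) ∞ μ := by
  obtain ⟨T, hT⟩ := h.exists_map t
  obtain ⟨M, hM, hb⟩ := mem_LInfty_iff.1 (hInf (-t) _ one_mem_LInfty)
  obtain ⟨r, hr, hrM⟩ := exists_bounded_representative hM hb
  have key : ∀ᵐ x ∂μ, 1 = U t (one μ) x * r (T x) := by
    have h1 := hT _ r hr
    rw [hU.apply_neg] at h1
    filter_upwards [h1, coeFn_one (μ := μ)] with x h2 h3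
    rw [← h2, h3]
  have hne : ∀ᵐ x ∂μ, U t (one μ) x ≠ 0 := by
    filter_upwards [key] with x hx h0
    simp [h0] at hx
  refine ⟨hne, memLp_top_of_bound (aestronglyMeasurable_one_div _) M ?_⟩
  filter_upwards [key, hne] with x hx h0
  rw [hx, mul_div_cancel_left₀ _ h0]
  exact hrM _

theorem IsWeightedNonsingular.exists_group (h : IsWeightedNonsingular U)
    (hU : IsC0Group U) (hInf : PreservesLInfty U) :
    ∃ V : ℝ → Lp ℂ 2 μ →L[ℂ] Lp ℂ 2 μ,
      (∀ (t : ℝ) (f : Lp ℂ 2 μ), ∀ᵐ x ∂μ, V t f x = 1 / U t (one μ) x * U t f x) ∧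
      IsC0Group V ∧
      (∀ t, ∀ f ∈ LInfty μ, ∀ g ∈ LInfty μ, V t (mul f g) = mul (V t f) (V t g)) ∧
      ∀ t M, 0 < M → ∀ f ∈ bddBall μ M, V t f ∈ bddBall μ M := by
  have hinv := fun t => h.ne_zero_and_memLp hU hInf t
  have hinv2 : ∀ t, MemLp (fun x => 1 / U t (one μ) x) 2 μ := fun t =>
    (hinv t).2.mono_exponent le_top
  have hwb : ∀ t, (hinv2 t).toLp ∈ LInfty μ := fun t =>
    (memLp_congr_ae (hinv2 t).coeFn_toLp).2 (hinv t).2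
  choose T hT using h.exists_map
  let V : ℝ → Lp ℂ 2 μ →L[ℂ] Lp ℂ 2 μ := fun t => (mulL _ (hwb t)).comp (U t)
  have hVU : ∀ (t : ℝ) (f : Lp ℂ 2 μ), ∀ᵐ x ∂μ, V t f x = 1 / U t (one μ) x * U t f x := by
    intro t f
    filter_upwards [coeFn_mul (g := U t f) (hwb t), (hinv2 t).coeFn_toLp] with x h1 h2
    change mul _ (U t f) x = _
    rw [h1, h2]
  have hUV : ∀ (t : ℝ) (f : Lp ℂ 2 μ), ∀ᵐ x ∂μ, U t f x = U t (one μ) x * V t f x := by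
    intro t f
    filter_upwards [hVU t f, (hinv t).1] with x h1 h2
    rw [h1]
    field_simp
  have hVT : ∀ (t : ℝ) (f : Lp ℂ 2 μ) (r : X → ℂ), f =ᵐ[μ] r → ∀ᵐ x ∂μ, V t f x = r (T t x) := by
    intro t f r hr
    filter_upwards [hVU t f, (hinv t).1, hT t f r hr] with x h1 h2 h3
    rw [h1, h3]
    field_simp
  clear_value V
  have h0 : V 0 = ContinuousLinearMap.id ℂ _ := by
    ext1 f
    refine Lp.ext ?_
    filter_upwards [hVU 0 f, coeFn_one (μ := μ)] with x h1 h2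
    rw [h1, hU.apply_zero, hU.apply_zero, h2]
    simp
  have hadd : ∀ s t, V (s + t) = (V s).comp (V t) := by
    intro s t
    ext1 f
    refine Lp.ext ?_
    -- Cocycle identity: `U (s + t) f` and `U (s + t) 1` share the factor `U s 1 · (U t 1 ∘ T s)`,
    -- which cancels in the quotient.
    have h1 := hT s (U t f) _ (hUV t f)
    have h2 := hT s (U t (one μ)) _ EventuallyEq.rfl
    rw [← hU.apply_add] at h1 h2
    filter_upwards [hVU (s + t) f, h1, h2, hVT s (V t f) _ EventuallyEq.rfl, (hinv (s + t)).1]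
      with x h3 h4 h5 h6 h7
    rw [ContinuousLinearMap.comp_apply, h3, h4, h6]
    rw [h5] at h7 ⊢
    rw [one_div, inv_mul_eq_div, ← mul_assoc, mul_div_cancel_left₀ _ h7]
  have hb : ∀ t M, 0 < M → ∀ f ∈ bddBall μ M, V t f ∈ bddBall μ M := by
    intro t M hM f hf
    obtain ⟨r, hr, hrM⟩ := exists_bounded_representative hM hf
    filter_upwards [hVT t f r hr] with x hx
    rw [hx]
    exact hrM _
  have hbI : ∀ t, ∀ f ∈ LInfty μ, V t f ∈ LInfty μ := by
    intro t f hf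
    obtain ⟨M, hM, hfM⟩ := mem_LInfty_iff.1 hf
    exact mem_LInfty_of_mem_bddBall (hb t M hM f hfM)
  refine ⟨V, hVU, ?_, ?_, hb⟩
  · refine isC0Group_of_dense h0 hadd (D := (LInfty μ : Set (Lp ℂ 2 μ))) ?_ ?_
    · refine Metric.dense_iff.2 fun f ε hε => ?_
      obtain ⟨g, hg, hfg⟩ := exists_mem_LInfty_norm_sub_lt f hε
      refine ⟨g, ?_, hg⟩
      rwa [Metric.mem_ball, dist_comm, dist_eq_norm]
    · intro f hf
      obtain ⟨M, hM, hfM⟩ := mem_LInfty_iff.1 hf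
      have hU0 : ∀ g, Tendsto (fun t => U t g) (𝓝 0) (𝓝 g) := fun g => by
        simpa [hU.apply_zero] using (hU.continuous_orbit g).tendsto 0
      -- Uses `V t f - f = (U t f - f · U t 1) + (V t f - f) · (1 - U t 1)`, which avoids any
      -- continuity of `1 / U t 1` in `t`.
      have h1 : Tendsto (fun t => U t f - mul f (U t (one μ))) (𝓝 0) (𝓝 0) := by
        have := (hU0 f).sub (((mulL f hf).continuous.tendsto _).comp (hU0 (one μ)))
        rwa [mulL_apply, mul_one' hf, sub_self] at this
      have h2 : Tendsto (fun t => mul (V t f - f) (one μ - U t (one μ))) (𝓝 0) (𝓝 0) := by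
        have h3 : Tendsto (fun t => (M + M) * ‖one μ - U t (one μ)‖) (𝓝 0) (𝓝 0) := by
          simpa using ((hU0 (one μ)).const_sub (one μ)).norm.const_mul (M + M)
        exact squeeze_zero_norm
          (fun t => norm_mul_le' (sub_mem_bddBall (hb t M hM f hfM) hfM)) h3
      have h4 := (h1.add h2).add_const f
      rw [add_zero, zero_add] at h4
      refine h4.congr fun t => ?_
      have h5 := (LInfty μ).sub_mem (hbI t f hf) hf
      rw [mul_sub' h5, mul_one' h5, sub_mul_of_bounded (hbI t f hf) hf,
        ← eq_mul_of_ae (h := U t f) (hbI t f hf) (by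
          filter_upwards [hUV t f] with x hx
          rw [hx, mul_comm])]
      abel
  · intro t f hf g hg
    refine eq_mul_of_ae (hbI t f hf) ?_
    filter_upwards [hVT t f _ EventuallyEq.rfl, hVT t g _ EventuallyEq.rfl,
      hVT t (mul f g) _ (coeFn_mul hf)] with x h1 h2 h3
    rw [h1, h2, h3]

end Weighted

/-! ### From the derivation property to multiplicativity on `L_∞`. -/

section Multiplicative

variable {X : Type*} [MeasurableSpace X] {μ : Measure X}

theorem apply_mem_bddBall_of_unit {W : Lp ℂ 2 μ →L[ℂ] Lp ℂ 2 μ} {C M : ℝ}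
    (hW : ∀ f ∈ bddBall μ 1, W f ∈ bddBall μ C) (hM : 0 < M) {f : Lp ℂ 2 μ}
    (hf : f ∈ bddBall μ M) : W f ∈ bddBall μ (C * M) := by
  have hn : ‖(M : ℂ)‖ = M := by rw [Complex.norm_real, Real.norm_of_nonneg hM.le]
  have hn' : ‖((M : ℂ))⁻¹‖ = M⁻¹ := by rw [norm_inv, hn]
  have h0 : (M : ℂ) ≠ 0 := by exact_mod_cast hM.ne'
  have h1 := smul_mem_bddBall ((M : ℂ)⁻¹) hf
  rw [hn', inv_mul_cancel₀ hM.ne'] at h1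
  have h2 := smul_mem_bddBall (M : ℂ) (hW _ h1)
  rwa [map_smul, smul_smul, mul_inv_cancel₀ h0, one_smul, hn, mul_comm] at h2

theorem real_smul_eq (c : ℝ) (f : Lp ℂ 2 μ) : c • f = (c : ℂ) • f := by
  refine Lp.ext ?_
  filter_upwards [Lp.coeFn_smul c f, Lp.coeFn_smul (c : ℂ) f] with x h1 h2
  rw [h1, h2, Pi.smul_apply, Pi.smul_apply, Complex.coe_smul]

instance completeSpace_bddBall (M : ℝ) : CompleteSpace (bddBall μ M) :=
  (isClosed_bddBall M).completeSpace_coe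

variable [IsFiniteMeasure μ]

/-- A jointly continuous family of operators that leave `L_∞` invariant is bounded on the unit ball
of `L_∞`, uniformly near some parameter. -/
theorem exists_locally_uniform_bound {Y : Type*} [TopologicalSpace Y] [Nonempty Y]
    [BaireSpace (Y × bddBall μ 1)] {W : Y → Lp ℂ 2 μ →L[ℂ] Lp ℂ 2 μ}
    (hc : Continuous fun p : Y × Lp ℂ 2 μ => W p.1 p.2)
    (hW : ∀ y, ∀ f ∈ LInfty μ, W y f ∈ LInfty μ) :
    ∃ y₀ C, 0 < C ∧ ∀ᶠ y in 𝓝 y₀, ∀ f ∈ bddBall μ 1, W y f ∈ bddBall μ C := by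
  have : Nonempty (bddBall μ 1) := ⟨⟨0, zero_mem_bddBall zero_le_one⟩⟩
  obtain ⟨n, ⟨y₀, f₀⟩, h⟩ := nonempty_interior_of_iUnion_of_closed
    (f := fun n : ℕ => {p : Y × bddBall μ 1 | W p.1 p.2 ∈ bddBall μ n})
    (fun n => (isClosed_bddBall _).preimage
      (hc.comp (continuous_fst.prodMk (continuous_subtype_val.comp continuous_snd))))
    (Set.eq_univ_of_forall fun p => by
      obtain ⟨M, -, hM⟩ := mem_LInfty_iff.1 (hW p.1 _ (mem_LInfty_of_mem_bddBall p.2.2))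
      obtain ⟨n, hn⟩ := exists_nat_ge M
      exact Set.mem_iUnion.2 ⟨n, bddBall_mono hn hM⟩)
  rw [mem_interior_iff_mem_nhds, nhds_prod_eq] at h
  obtain ⟨P, hP, Q, hQ, hPQ⟩ := Filter.eventually_prod_iff.1 h
  obtain ⟨ε, hε, hball⟩ := Metric.eventually_nhds_iff.1 hQ
  set K := 2 * ‖one μ‖ with hK
  have hK0 : 0 ≤ K := by positivity
  -- `K` bounds the `L_2` diameter of the unit ball, so shrinking the ball towards `f₀` by `δ` puts
  -- it in the good neighbourhood; `δ ≤ 1` keeps it in the ball by convexity.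
  set δ := ε / (K + 1 + ε) with hδ
  have hδ0 : 0 < δ := by positivity
  have hδ1 : δ ≤ 1 := (div_le_one (by positivity)).2 (by linarith)
  have hδK : δ * K < ε := by
    rw [hδ, div_mul_eq_mul_div, div_lt_iff₀ (by positivity)]
    nlinarith
  -- From `W f = δ⁻¹ (W (f₀ + δ (f - f₀)) - W f₀) + W f₀`; the `1` only ensures positivity.
  refine ⟨y₀, δ⁻¹ * (n + n) + n + 1, by positivity, ?_⟩
  filter_upwards [hP] with y hy f hf
  have hg : (f₀ : Lp ℂ 2 μ) + δ • (f - f₀) ∈ bddBall μ 1 :=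
    (convex_bddBall 1).add_smul_sub_mem f₀.2 hf ⟨hδ0.le, hδ1⟩
  have h1 : W y (f₀ + δ • (f - f₀)) ∈ bddBall μ n := by
    refine hPQ hy (y := ⟨_, hg⟩) (hball ?_)
    rw [Subtype.dist_eq, dist_eq_norm, add_sub_cancel_left, norm_smul,
      Real.norm_of_nonneg hδ0.le]
    refine lt_of_le_of_lt ?_ hδK
    gcongr
    have := norm_sub_le f (f₀ : Lp ℂ 2 μ)
    linarith [norm_le_norm_one hf, norm_le_norm_one f₀.2]
  have h2 : W y f₀ ∈ bddBall μ n := hPQ hy (hball (by simpa using hε))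
  have h3 := add_mem_bddBall
    (smul_mem_bddBall ((δ⁻¹ : ℝ) : ℂ) (sub_mem_bddBall h1 h2)) h2
  rw [Complex.norm_real, Real.norm_of_nonneg (inv_nonneg.2 hδ0.le), ← map_sub,
    add_sub_cancel_left, real_smul_eq, map_smul, smul_smul, ← Complex.ofReal_mul,
    inv_mul_cancel₀ hδ0.ne', Complex.ofReal_one, one_smul, map_sub, sub_add_cancel] at h3
  exact bddBall_mono (by linarith) h3

theorem exists_bound_of_preserves {W : Lp ℂ 2 μ →L[ℂ] Lp ℂ 2 μ}
    (hW : ∀ f ∈ LInfty μ, W f ∈ LInfty μ) :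
    ∃ C, 0 < C ∧ ∀ M, 0 < M → ∀ f ∈ bddBall μ M, W f ∈ bddBall μ (C * M) := by
  obtain ⟨_, C, hC, h⟩ := exists_locally_uniform_bound (Y := Unit) (W := fun _ => W)
    (W.continuous.comp continuous_snd) fun _ => hW
  exact ⟨C, hC, fun M hM f hf => apply_mem_bddBall_of_unit h.self_of_nhds hM hf⟩

variable {V : ℝ → Lp ℂ 2 μ →L[ℂ] Lp ℂ 2 μ}

/-- Baire gives a bound near some uncontrolled `t₀`; writing `V t = V (t₀ + t) V (-t₀)` moves it to
`0`. -/
theorem IsC0Group.exists_local_bound (hV : IsC0Group V) (hInf : PreservesLInfty V) :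
    ∃ C, 0 < C ∧ ∀ᶠ t in 𝓝 0, ∀ M, 0 < M → ∀ f ∈ bddBall μ M, V t f ∈ bddBall μ (C * M) := by
  obtain ⟨t₀, C, hC, h⟩ := exists_locally_uniform_bound hV.continuous_uncurry hInf
  obtain ⟨C', hC', h'⟩ := exists_bound_of_preserves (hInf (-t₀))
  refine ⟨C * C', by positivity, ?_⟩
  have h1 : Tendsto (fun s => t₀ + s) (𝓝 0) (𝓝 t₀) := by
    simpa using (continuous_const_add t₀).tendsto 0
  filter_upwards [h1.eventually h] with t ht M hM f hf
  have h2 := apply_mem_bddBall_of_unit ht (by positivity) (h' M hM f hf)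
  rwa [← hV.apply_add, ← mul_assoc, add_neg_cancel_comm] at h2

/-- Bounded functions are limits of uniformly bounded elements of the domain of the generator. -/
theorem IsC0Group.exists_approximation (hV : IsC0Group V) (hInf : PreservesLInfty V)
    {f : Lp ℂ 2 μ} (hf : f ∈ LInfty μ) :
    ∃ (M : ℝ) (a : ℝ → Lp ℂ 2 μ), 0 < M ∧ Tendsto a (𝓝[>] 0) (𝓝 f) ∧
      ∀ᶠ s in 𝓝[>] 0, a s ∈ bddBall μ M ∧ a s ∈ (generator V).domain := by
  obtain ⟨N, hN, hfN⟩ := mem_LInfty_iff.1 hf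
  obtain ⟨C, hC, hCb⟩ := hV.exists_local_bound hInf
  have hc := hV.continuous_orbit f
  refine ⟨C * N, fun s => s⁻¹ • ∫ r in (0 : ℝ)..s, V r f, by positivity, ?_, ?_⟩
  · have h1 := (hc.integral_hasStrictDerivAt 0 0).hasDerivAt
    rw [hasDerivAt_iff_tendsto_slope_zero, hV.apply_zero] at h1
    simpa using h1.mono_left (nhdsWithin_mono 0 (s := Set.Ioi 0)
      fun s hs => (Set.mem_Ioi.1 hs).ne')
  · obtain ⟨ε, hε, hball⟩ := Metric.eventually_nhds_iff.1 hCb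
    filter_upwards [Ioo_mem_nhdsGT hε] with s hs
    constructor
    -- An average of points of a closed convex set stays in it, so the `L_∞` bound survives the
    -- `L_2`-valued integral.
    · have h2 : s⁻¹ • ∫ r in (0 : ℝ)..s, V r f = ⨍ r in Set.uIoc 0 s, V r f := by
        rw [interval_average_eq, sub_zero]
      rw [h2, Set.uIoc_of_le hs.1.le]
      refine (convex_bddBall (C * N)).set_average_mem (isClosed_bddBall _) ?_ ?_ ?_ ?_
      · simpa using hs.1
      · simp
      · refine (ae_restrict_iff' measurableSet_Ioc).2 (Eventually.of_forall fun r hr => ?_)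
        refine hball ?_ N hN f hfN
        rw [dist_zero_right, Real.norm_of_nonneg hr.1.le]
        exact hr.2.trans_lt hs.2
      · exact hc.integrableOn_Ioc
    · have h3 := (generator V).domain.smul_mem ((s⁻¹ : ℝ) : ℂ)
        (⟨_, hV.hasOrbitDeriv_integral f s⟩ : _ ∈ (generator V).domain)
      rwa [Complex.coe_smul] at h3

theorem IsC0Group.map_mul_of_mem_domain (hV : IsC0Group V) (hInf : PreservesLInfty V)
    (hD : IsDerivationOn (generator V) ((generator V).domain ⊓ LInfty μ)) {f g : Lp ℂ 2 μ}
    (hf : f ∈ (generator V).domain ⊓ LInfty μ) (hg : g ∈ (generator V).domain ⊓ LInfty μ)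
    (t : ℝ) : V t (mul f g) = mul (V t f) (V t g) := by
  obtain ⟨-, halg, hder⟩ := hD
  obtain ⟨C, hC, hCb⟩ := hV.exists_local_bound hInf
  have hinv : ∀ s, ∀ F ∈ (generator V).domain ⊓ LInfty μ,
      V s F ∈ (generator V).domain ⊓ LInfty μ := by
    rintro s F ⟨⟨F', hF⟩, hFb⟩
    exact ⟨⟨_, hF.apply hV s⟩, hInf s F hFb⟩
  -- By the derivation rule, `V h F · V h G` and `V h (F G)` agree to first order at `h = 0`.
  have key : ∀ F ∈ (generator V).domain ⊓ LInfty μ, ∀ G ∈ (generator V).domain ⊓ LInfty μ,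
      Tendsto (fun h : ℝ => ((h : ℂ)⁻¹) • (mul (V h F) (V h G) - V h (mul F G))) (𝓝[≠] 0)
        (𝓝 0) := by
    intro F hF G hG
    obtain ⟨M, hM, hGM⟩ := mem_LInfty_iff.1 hG.2
    obtain ⟨H, hH, hHe⟩ := halg F hF G hG
    have hHm := eq_mul_of_ae hF.2 hHe
    have h1 := tendsto_mul_orbit hV (generator_spec V ⟨F, hF.1⟩) (generator_spec V ⟨G, hG.1⟩)
      hF.2 (M := C * M) (by positivity) (by
        filter_upwards [nhdsWithin_le_nhds hCb] with h hh using hh M hM G hGM)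
    have h2 := generator_spec V ⟨H, hH.1⟩
    have h3 : generator V ⟨H, hH.1⟩ =
        mul (generator V ⟨F, hF.1⟩) G + mul F (generator V ⟨G, hG.1⟩) := by
      refine Lp.ext ?_
      have h5 := coeFn_mul (g := generator V ⟨F, hF.1⟩) hG.2
      rw [mul_comm'] at h5
      filter_upwards [hder ⟨F, hF.1⟩ ⟨G, hG.1⟩ ⟨H, hH.1⟩ hF hG hH hHe, h5,
        coeFn_mul (g := generator V ⟨G, hG.1⟩) hF.2,
        Lp.coeFn_add (mul (generator V ⟨F, hF.1⟩) G) (mul F (generator V ⟨G, hG.1⟩))]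
        with x e1 e2 e3 e4
      rw [e1, e4, Pi.add_apply, e2, e3, mul_comm (G x)]
    have h4 := h1.sub h2
    simp only at h4
    rw [h3, sub_self] at h4
    refine h4.congr fun h => ?_
    rw [← smul_sub, hHm]
    congr 1
    abel
  have hderiv : ∀ s, HasDerivAt (fun s => V (-s) (mul (V s f) (V s g))) 0 s := by
    intro s
    rw [hasDerivAt_iff_tendsto_slope_zero]
    obtain ⟨K, -, hK⟩ := hV.exists_bound (|s| + 1)
    have h1 : ∀ᶠ h in 𝓝[≠] (0 : ℝ), ‖V (-(s + h))‖ ≤ K := by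
      have : Tendsto (fun h => |(-(s + h))|) (𝓝 0) (𝓝 |s|) := by
        have hcont : Continuous fun h : ℝ => |(-(s + h))| := by fun_prop
        simpa using hcont.tendsto 0
      filter_upwards [nhdsWithin_le_nhds (this.eventually (gt_mem_nhds (lt_add_one |s|)))]
        with h hh using hK _ hh.le
    refine (tendsto_apply_of_bound h1 (key _ (hinv s f hf) _ (hinv s g hg))
      (g := 0) (by simp)).congr fun h => ?_
    rw [← hV.apply_add, ← hV.apply_add, map_smul, map_sub, ← hV.apply_add, ← Complex.ofReal_inv,
      Complex.coe_smul, add_comm h s]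
    congr 4
    ring
  have hconst := is_const_of_deriv_eq_zero (fun s => (hderiv s).differentiableAt)
    (fun s => (hderiv s).deriv) t 0
  simp only [neg_zero, hV.apply_zero] at hconst
  rw [← hconst, hV.apply_neg]

/-- Time averages approximate `f` and `g` in `L_2` with uniform `L_∞` bounds, which lets both
products converge. -/
theorem IsC0Group.map_mul (hV : IsC0Group V) (hInf : PreservesLInfty V)
    (hD : IsDerivationOn (generator V) ((generator V).domain ⊓ LInfty μ)) {f g : Lp ℂ 2 μ}
    (hf : f ∈ LInfty μ) (hg : g ∈ LInfty μ) (t : ℝ) : V t (mul f g) = mul (V t f) (V t g) := by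
  obtain ⟨M, a, -, ha, haD⟩ := hV.exists_approximation hInf hf
  obtain ⟨N, b, hN, hb, hbD⟩ := hV.exists_approximation hInf hg
  obtain ⟨C, hC, hCb⟩ := exists_bound_of_preserves (hInf t)
  have h1 := ((V t).continuous.tendsto _).comp
    (tendsto_mul hN (hbD.mono fun s hs => hs.1) ha hb)
  have h2 := tendsto_mul (M := C * N) (by positivity)
    (hbD.mono fun s hs => hCb N hN _ hs.1) (((V t).continuous.tendsto f).comp ha)
    (((V t).continuous.tendsto g).comp hb)
  refine tendsto_nhds_unique_of_eventuallyEq h1 h2 ?_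
  filter_upwards [haD, hbD] with s hs hs'
  exact hV.map_mul_of_mem_domain hInf hD ⟨hs.2, mem_LInfty_of_mem_bddBall hs.1⟩
    ⟨hs'.2, mem_LInfty_of_mem_bddBall hs'.1⟩ t

end Multiplicative

/-! ### Unital multiplicative operators as composition with a point map. -/

section PointRealization

variable {X : Type*} [MeasurableSpace X] {μ : Measure X} [IsFiniteMeasure μ]

/-- The indicator function of a measurable set, as an element of `L_2`. -/
noncomputable def ind (μ : Measure X) [IsFiniteMeasure μ] {A : Set X} (hA : MeasurableSet A) :
    Lp ℂ 2 μ :=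
  indicatorConstLp 2 hA (measure_ne_top μ A) 1

theorem coeFn_ind {A : Set X} (hA : MeasurableSet A) :
    ind μ hA =ᵐ[μ] A.indicator fun _ => 1 :=
  indicatorConstLp_coeFn

theorem ind_mem_LInfty {A : Set X} (hA : MeasurableSet A) : ind μ hA ∈ LInfty μ := by
  refine mem_LInfty_of_mem_bddBall (M := 1) ?_
  filter_upwards [coeFn_ind (μ := μ) hA] with x hx
  rw [hx]
  exact (norm_indicator_le_norm_self _ _).trans_eq norm_one

/-- The operator `W` maps the indicator function of `A` to that of `B`. -/
def MapsInd (W : Lp ℂ 2 μ →L[ℂ] Lp ℂ 2 μ) (A B : Set X) : Prop :=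
  ∃ hA : MeasurableSet A, W (ind μ hA) =ᵐ[μ] B.indicator fun _ => 1

variable {W : Lp ℂ 2 μ →L[ℂ] Lp ℂ 2 μ}

theorem MapsInd.congr {A B B' : Set X} (h : MapsInd W A B) (hB : ∀ᵐ x ∂μ, x ∈ B ↔ x ∈ B') :
    MapsInd W A B' := by
  classical
  refine ⟨h.1, ?_⟩
  filter_upwards [h.2, hB] with x h1 h2
  rw [h1, Set.indicator_apply, Set.indicator_apply]
  simp only [h2]

theorem MapsInd.compl (hone : W (one μ) = one μ) {A B : Set X} (h : MapsInd W A B) :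
    MapsInd W Aᶜ Bᶜ := by
  classical
  obtain ⟨hA, h⟩ := h
  refine ⟨hA.compl, ?_⟩
  have h1 : ind μ hA.compl = one μ - ind μ hA := by
    refine Lp.ext ?_
    filter_upwards [coeFn_ind (μ := μ) hA, coeFn_ind (μ := μ) hA.compl, coeFn_one (μ := μ),
      Lp.coeFn_sub (one μ) (ind μ hA)] with x e1 e2 e3 e4
    rw [e4, Pi.sub_apply, e1, e2, e3]
    by_cases hx : x ∈ A <;> simp [hx]
  rw [h1, map_sub, hone]
  filter_upwards [h, coeFn_one (μ := μ), Lp.coeFn_sub (one μ) (W (ind μ hA))] with x e1 e2 e3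
  rw [e3, Pi.sub_apply, e1, e2]
  by_cases hx : x ∈ B <;> simp [hx]

theorem MapsInd.empty : MapsInd W ∅ ∅ := by
  refine ⟨MeasurableSet.empty, ?_⟩
  have h1 : ind μ (MeasurableSet.empty (α := X)) = 0 := indicatorConstLp_empty
  rw [h1, map_zero, Set.indicator_empty]
  exact Lp.coeFn_zero ℂ 2 μ

variable (hW : ∀ f ∈ LInfty μ, W f ∈ LInfty μ) (hone : W (one μ) = one μ)
  (hmul : ∀ f ∈ LInfty μ, ∀ g ∈ LInfty μ, W (mul f g) = mul (W f) (W g))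

include hW hmul

theorem MapsInd.inter {A B A' B' : Set X} (h : MapsInd W A B) (h' : MapsInd W A' B') :
    MapsInd W (A ∩ A') (B ∩ B') := by
  obtain ⟨hA, h⟩ := h
  obtain ⟨hA', h'⟩ := h'
  refine ⟨hA.inter hA', ?_⟩
  have h1 : ind μ (hA.inter hA') = mul (ind μ hA) (ind μ hA') := by
    refine eq_mul_of_ae (ind_mem_LInfty hA) ?_
    filter_upwards [coeFn_ind (μ := μ) hA, coeFn_ind (μ := μ) hA',
      coeFn_ind (μ := μ) (hA.inter hA')] with x e1 e2 e3
    rw [e1, e2, e3]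
    by_cases hx : x ∈ A <;> by_cases hx' : x ∈ A' <;> simp [hx, hx']
  rw [h1, hmul _ (ind_mem_LInfty hA) _ (ind_mem_LInfty hA')]
  filter_upwards [h, h', coeFn_mul (g := W (ind μ hA')) (hW _ (ind_mem_LInfty hA))] with x e1 e2 e3
  rw [e3, e1, e2]
  by_cases hx : x ∈ B <;> by_cases hx' : x ∈ B' <;> simp [hx, hx']

/-- The image of an indicator is idempotent, hence takes only the values `0` and `1` a.e. -/
theorem exists_mapsInd {A : Set X} (hA : MeasurableSet A) :
    ∃ B, MapsInd W A B := by
  refine ⟨W (ind μ hA) ⁻¹' {1}, hA, ?_⟩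
  have h1 : mul (ind μ hA) (ind μ hA) = ind μ hA := by
    refine (eq_mul_of_ae (ind_mem_LInfty hA) ?_).symm
    filter_upwards [coeFn_ind (μ := μ) hA] with x e1
    rw [e1]
    by_cases hx : x ∈ A <;> simp [hx]
  have h2 := coeFn_mul (g := W (ind μ hA)) (hW _ (ind_mem_LInfty hA))
  rw [← hmul _ (ind_mem_LInfty hA) _ (ind_mem_LInfty hA), h1] at h2
  filter_upwards [h2] with x hx
  by_cases hx1 : W (ind μ hA) x = 1
  · simp [hx1]
  · rw [Set.indicator_of_notMem (by simpa using hx1)]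
    by_contra h0
    exact hx1 (mul_left_cancel₀ h0 (by rw [mul_one, ← hx]))

include hone

theorem MapsInd.union {A B A' B' : Set X} (h : MapsInd W A B) (h' : MapsInd W A' B') :
    MapsInd W (A ∪ A') (B ∪ B') := by
  have := (MapsInd.inter hW hmul (h.compl hone) (h'.compl hone)).compl hone
  simpa only [Set.compl_inter, compl_compl] using this

/-- Finite unions increase to the union, so their indicators converge in `L_2`; continuity of `W`
and an a.e. convergent subsequence identify the image. -/
theorem MapsInd.iUnion {A B : ℕ → Set X} (h : ∀ n, MapsInd W (A n) (B n)) :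
    MapsInd W (⋃ n, A n) (⋃ n, B n) := by
  have hacc : ∀ n, MapsInd W (Set.accumulate A n) (Set.accumulate B n) := by
    intro n
    induction n with
    | zero => simpa using h 0
    | succ n ih =>
      rw [Set.accumulate_succ, Set.accumulate_succ]
      exact MapsInd.union hW hone hmul ih (h (n + 1))
  choose hA hAB using hacc
  have hm : MeasurableSet (⋃ n, A n) := MeasurableSet.iUnion fun n => (h n).1
  refine ⟨hm, ?_⟩
  have h1 : Tendsto (fun n => ind μ (hA n)) atTop (𝓝 (ind μ hm)) := by
    refine tendsto_indicatorConstLp_set (by norm_num) ?_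
    have h2 := ENNReal.Tendsto.sub (tendsto_const_nhds (x := μ (⋃ n, A n)) (f := atTop))
      (tendsto_measure_iUnion_accumulate (μ := μ) (f := A)) (Or.inl (measure_ne_top _ _))
    rw [tsub_self] at h2
    refine h2.congr fun n => ?_
    have h3 : Set.accumulate A n ⊆ ⋃ n, A n := Set.accumulate_subset_iUnion n
    rw [Set.symmDiff_def, Set.sdiff_eq_empty.2 h3, Set.empty_union,
      measure_sdiff h3 (hA n).nullMeasurableSet (measure_ne_top _ _)]
  obtain ⟨k, hk, hkt⟩ := exists_subseq_tendsto_ae ((W.continuous.tendsto _).comp h1)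
  filter_upwards [hkt, ae_all_iff.2 hAB] with x hx hB
  have h3 := Monotone.tendsto_indicator _ (Set.monotone_accumulate (s := B)) (fun _ => (1 : ℂ)) x
  rw [Set.iUnion_accumulate] at h3
  refine tendsto_nhds_unique hx (((h3.mono_right (pure_le_nhds _)).comp hk.tendsto_atTop).congr
    fun i => ?_)
  exact (hB (k i)).symm

/-- The sets `C` for which the indicator function of `e ⁻¹' C` is mapped to that of `h ⁻¹' C`. -/
@[reducible]
def mapsIndSpace {Y : Type*} (e h : X → Y) : MeasurableSpace Y where
  MeasurableSet' C := MapsInd W (e ⁻¹' C) (h ⁻¹' C)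
  measurableSet_empty := MapsInd.empty
  measurableSet_compl _ hC := hC.compl hone
  measurableSet_iUnion C hC := by
    simpa only [Set.preimage_iUnion] using MapsInd.iUnion hW hone hmul hC

/-- Embed `X` in Cantor space by `e`, and let the `n`-th coordinate of `h` record the set assigned
to `{e n = true}`. The sets `C` with `e ⁻¹' C` sent to `h ⁻¹' C` form a σ-algebra containing the
cylinders, so `T = e⁻¹ ∘ h` works. -/
theorem exists_map_mapsInd [StandardBorelSpace X] [Nonempty X] :
    ∃ T : X → X, ∀ A, MeasurableSet A → MapsInd W A (T ⁻¹' A) := by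
  classical
  obtain ⟨e, he, hinj⟩ := MeasurableSpace.measurable_injection_nat_bool_of_countablySeparated X
  have hemb := he.measurableEmbedding hinj
  choose B hB using fun n => exists_mapsInd hW hmul (A := (fun x => e x n) ⁻¹' {true})
    ((measurable_pi_iff.1 he n) (measurableSet_singleton true))
  let h : X → ℕ → Bool := fun x n => decide (x ∈ B n)
  have hm : MeasurableSpace.pi ≤ mapsIndSpace hW hone hmul e h := by
    refine iSup_le fun n => ?_
    rintro _ ⟨S, -, rfl⟩
    have h1 : MeasurableSet[mapsIndSpace hW hone hmul e h] ((fun c : ℕ → Bool => c n) ⁻¹' {true}) := by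
      change MapsInd W (e ⁻¹' _) (h ⁻¹' _)
      refine (hB n).congr (Eventually.of_forall fun x => ?_)
      simp [h]
    have h2 : S = (⋃ _ : true ∈ S, {true}) ∪ (⋃ _ : false ∈ S, {true}ᶜ) := by
      ext b
      cases b <;> simp
    rw [h2, Set.preimage_union, Set.preimage_iUnion, Set.preimage_iUnion]
    exact MeasurableSet.union (m := mapsIndSpace hW hone hmul e h) (MeasurableSet.iUnion fun _ => h1)
      (MeasurableSet.iUnion fun _ => h1.compl)
  have hmaps : ∀ C : Set (ℕ → Bool), MeasurableSet C → MapsInd W (e ⁻¹' C) (h ⁻¹' C) :=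
    fun C hC => hm C hC
  -- The preimage of `range e` under `e` is all of `X`, and `W 1 = 1`.
  have hrange : ∀ᵐ x ∂μ, h x ∈ Set.range e := by
    obtain ⟨hu, h1⟩ := hmaps _ hemb.measurableSet_range
    have h2 : ind μ hu = one μ := by
      refine Lp.ext ?_
      filter_upwards [coeFn_ind (μ := μ) hu, coeFn_one (μ := μ)] with x e1 e2
      rw [e1, e2, Set.preimage_range, Set.indicator_univ]
    rw [h2, hone] at h1
    filter_upwards [h1, coeFn_one (μ := μ)] with x e1 e2
    by_contra hx
    rw [e2, Set.indicator_of_notMem (s := h ⁻¹' Set.range e) hx] at e1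
    exact one_ne_zero e1
  refine ⟨fun x => Function.invFun e (h x), fun A hA => ?_⟩
  have h1 := hmaps _ (hemb.measurableSet_image.2 hA)
  rw [Set.preimage_image_eq _ hinj] at h1
  refine h1.congr ?_
  filter_upwards [hrange] with x hx
  obtain ⟨y, hy⟩ := hx
  simp only [Set.mem_preimage]
  rw [← hy, Function.leftInverse_invFun hinj y, hinj.mem_set_image]

omit hW hone hmul

/-- Null sets have zero indicator in `L_2`, and `W 0 = 0`. Hence a.e. equality and a.e. convergence
can be composed with `T`. -/
theorem MapsInd.preimage_null {T : X → X} (hT : ∀ A, MeasurableSet A → MapsInd W A (T ⁻¹' A))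
    {p : X → Prop} (hp : ∀ᵐ x ∂μ, p x) : ∀ᵐ x ∂μ, p (T x) := by
  set N := toMeasurable μ {x | ¬ p x} with hN
  have hN0 : μ N = 0 := by rw [hN, measure_toMeasurable]; exact hp
  obtain ⟨hNm, h⟩ := hT N (measurableSet_toMeasurable _ _)
  have h0 : ind μ hNm = 0 := by
    refine Lp.ext ?_
    filter_upwards [coeFn_ind (μ := μ) hNm, Lp.coeFn_zero ℂ 2 μ, measure_eq_zero_iff_ae_notMem.1 hN0]
      with x e1 e2 e3
    rw [e1, e2, Set.indicator_of_notMem e3]; rfl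
  rw [h0, map_zero] at h
  filter_upwards [h, Lp.coeFn_zero ℂ 2 μ] with x e1 e2
  by_contra hx
  have : x ∈ T ⁻¹' N := subset_toMeasurable μ _ hx
  rw [e2, Set.indicator_of_mem this] at e1
  exact zero_ne_one e1

theorem apply_toLp_ae_eq_comp {T : X → X}
    (hT : ∀ A, MeasurableSet A → MapsInd W A (T ⁻¹' A)) {f : X → ℂ} (hf : MemLp f 2 μ) :
    ∀ᵐ x ∂μ, W (hf.toLp f) x = f (T x) := by
  suffices H : ∀ hf : MemLp f 2 μ, ∀ᵐ x ∂μ, W (hf.toLp f) x = f (T x) from H hf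
  refine MemLp.induction (by norm_num)
    (fun f => ∀ hf : MemLp f 2 μ, ∀ᵐ x ∂μ, W (hf.toLp f) x = f (T x)) ?_ ?_ ?_ ?_ hf
  · intro c A hA _ hf
    obtain ⟨hA, h⟩ := hT A hA
    have h1 : hf.toLp _ = c • ind μ hA := by
      refine Lp.ext ?_
      filter_upwards [coeFn_ind (μ := μ) hA, hf.coeFn_toLp, Lp.coeFn_smul c (ind μ hA)]
        with x e1 e2 e3
      rw [e2, e3, Pi.smul_apply, e1]
      by_cases hx : x ∈ A <;> simp [hx]
    rw [h1, map_smul]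
    filter_upwards [h, Lp.coeFn_smul c (W (ind μ hA))] with x e1 e2
    rw [e2, Pi.smul_apply, e1]
    by_cases hx : T x ∈ A <;> simp [hx]
  · intro f g _ hf hg h1 h2 hfg
    rw [MemLp.toLp_add hf hg, map_add]
    filter_upwards [h1 hf, h2 hg, Lp.coeFn_add (W (hf.toLp f)) (W (hg.toLp g))] with x e1 e2 e3
    rw [e3, Pi.add_apply, e1, e2, Pi.add_apply]
  · refine IsSeqClosed.isClosed fun f g hf hfg hg => ?_
    rw [Lp.toLp_coeFn]
    -- Two successive subsequences: one for a.e. convergence of `f`, to be pulled back along `T`,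
    -- and a further one for that of `W f`.
    obtain ⟨k, hk, hkt⟩ := exists_subseq_tendsto_ae hfg
    obtain ⟨l, hl, hlt⟩ := exists_subseq_tendsto_ae
      ((W.continuous.tendsto _).comp (hfg.comp hk.tendsto_atTop))
    have h1 : ∀ n, ∀ᵐ x ∂μ, W (f n) x = f n (T x) := fun n => by
      have := hf n (Lp.memLp _)
      rwa [Lp.toLp_coeFn] at this
    filter_upwards [hlt, ae_all_iff.2 h1, MapsInd.preimage_null hT hkt] with x e1 e2 e3
    refine tendsto_nhds_unique e1 ((e3.comp hl.tendsto_atTop).congr fun i => ?_)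
    exact (e2 _).symm
  · intro f g hfg hf h hg
    rw [← (MemLp.toLp_eq_toLp_iff hf hg).2 hfg]
    filter_upwards [h hf, MapsInd.preimage_null hT hfg] with x e1 e2
    rw [e1, e2]

end PointRealization

end WeightedKoopman

theorem proposition3p6 {X : Type*} [MeasurableSpace X] [StandardBorelSpace X]
    (μ : Measure X) [IsProbabilityMeasure μ]
    (U : ℝ → Lp ℂ 2 μ →L[ℂ] Lp ℂ 2 μ)
    (hU : WeightedKoopman.IsC0Group U)
    (hInf : WeightedKoopman.PreservesLInfty U) :
    WeightedKoopman.IsWeightedNonsingular U ↔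
      (∀ t : ℝ,
        (∀ᵐ x ∂μ, U t (WeightedKoopman.one μ) x ≠ 0) ∧
        MemLp (fun x => 1 / U t (WeightedKoopman.one μ) x) ∞ μ) ∧
      ∃ V : ℝ → Lp ℂ 2 μ →L[ℂ] Lp ℂ 2 μ,
        (∀ (t : ℝ) (f : Lp ℂ 2 μ),
          ∀ᵐ x ∂μ, V t f x = 1 / U t (WeightedKoopman.one μ) x * U t f x) ∧
        WeightedKoopman.IsC0Group V ∧
        WeightedKoopman.IsAlgebra
          ((WeightedKoopman.generator V).domain ⊓ WeightedKoopman.LInfty μ) ∧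
        WeightedKoopman.IsDerivationOn (WeightedKoopman.generator V)
          ((WeightedKoopman.generator V).domain ⊓ WeightedKoopman.LInfty μ) := by
  open WeightedKoopman in
  constructor
  · intro h
    obtain ⟨V, hVU, hV, hmul, hb⟩ := h.exists_group hU hInf
    exact ⟨h.ne_zero_and_memLp hU hInf, V, hVU, hV, isAlgebra_and_isDerivationOn hV hmul hb⟩
  · rintro ⟨hinv, V, hVU, hV, -, hD⟩ t
    have hVInf : PreservesLInfty V := by
      intro s f hf
      obtain ⟨M, hM, hfM⟩ := mem_LInfty_iff.1 (hInf s f hf)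
      refine mem_LInfty_of_mem_bddBall
        (M := lpNorm (fun x => 1 / U s (one μ) x) ∞ μ * M) ?_
      filter_upwards [hVU s f, hfM, ae_le_lpNorm_exponent_top (hinv s).2] with x h1 h2 h3
      rw [h1, norm_mul]
      exact mul_le_mul h3 h2 (norm_nonneg _) ((norm_nonneg _).trans h3)
    have hone : V t (one μ) = one μ := by
      refine Lp.ext ?_
      filter_upwards [hVU t (one μ), (hinv t).1, coeFn_one (μ := μ)] with x h1 h2 h3
      rw [h1, h3, one_div, inv_mul_cancel₀ h2]
    have : Nonempty X := nonempty_of_isProbabilityMeasure μ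
    obtain ⟨T, hT⟩ := exists_map_mapsInd (hVInf t) hone
      fun f hf g hg => hV.map_mul hVInf hD hf hg t
    refine ⟨T, U t (one μ), fun f hf => ?_⟩
    filter_upwards [hVU t (hf.toLp f), (hinv t).1, apply_toLp_ae_eq_comp hT hf] with x h1 h2 h3
    rw [← h3, h1, ← mul_assoc, mul_one_div_cancel h2, one_mul]
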